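/- Let $X$ be a compact metrizable space. Write $H(X)$ for the group of homeomorphisms of $X$ onto itself, and for $h\in H(X)$ put $\mathrm{Move}(h)=\{x\in X: h(x)\neq x\}$. Let $O_X$ be the set of points of $X$ that have a neighborhood homeomorphic to $(0,1)$, and let $C_X=X\setminus O_X$. Fix any metric $d$ on $X$ inducing its topology. For a subset $C\subseteq X$ and $\epsilon>0$ let $C_\epsilon=\{x\in X: d(x,C)<\epsilon\}$ (with $C_\epsilon=\emptyset$ if $C=\emptyset$) and $$B_\epsilon^{C}=\{h\in H(X): d(h(x),x)<\epsilon \text{ and } d(h^{-1}(x),x)<\epsilon \text{ for all } x\in X\setminus C_\epsilon\},$$ and let $\tau_{k|C}$ be the topology on $H(X)$ whose open sets are the unions of translates $fB_\epsilon^{C}$, with $f\in H(X)$ and $\epsilon>0$. Suppose that $O_X$ is dense in $X$, and let $G$ be a subgroup of $H(X)$ such that for every open subset $U$ of $X$ homeomorphic to $(0,1)$ there is a non-trivial $g\in G$ with $\mathrm{Move}(g)\subseteq U$. Then the restriction (subspace topology) of $\tau_{k|C_X}$ to $G$ is the minimum Hausdorff group topology on $G$: it is a Hausdorff topology making $G$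 a topological group, and it is contained in every Hausdorff topology on $G$ that makes $G$ a topological group. -/

import Mathlib

/-- The one-manifold part `O_X` of a space `X`: the points that have a neighbourhood
homeomorphic to the open interval `(0,1)`. -/
def oneManifoldPart (X : Type*) [TopologicalSpace X] : Set X :=
  {x | ∃ N ∈ nhds x, Nonempty (N ≃ₜ Set.Ioo (0 : ℝ) 1)}

/-- `Move(h)`, the set of points moved by a homeomorphism `h`. -/
def movedSet {X : Type*} [TopologicalSpace X] (h : X ≃ₜ X) : Set X :=
  {x | h x ≠ x}

/-- The basic set
`B_ε = {h ∈ H(X) | d(h(x),x) < ε and d(h⁻¹(x),x) < ε for all x ∈ X \ C_ε}`, where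
`C_ε = {x | d(x,C) < ε}` (which is empty if `C` is empty). -/
def shrunkBall {X : Type*} [MetricSpace X] (C : Set X) (ε : ℝ) : Set (X ≃ₜ X) :=
  {h | ∀ x, x ∉ Metric.thickening ε C → dist (h x) x < ε ∧ dist (h⁻¹ x) x < ε}

/-- The translate `f B_ε` in `H(X)`. -/
def shrunkTranslate {X : Type*} [MetricSpace X] (C : Set X) (f : X ≃ₜ X) (ε : ℝ) :
    Set (X ≃ₜ X) :=
  (fun h => f * h) '' shrunkBall C ε

theorem shrunkBall_mono {X : Type*} [MetricSpace X] (C : Set X) {δ ε : ℝ} (h : δ ≤ ε) :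
    shrunkBall C δ ⊆ shrunkBall C ε := by
  intro g hg x hx
  have := hg x (fun hx' => hx (Metric.thickening_mono h C hx'))
  exact ⟨this.1.trans_le h, this.2.trans_le h⟩

/-- In a compact space, each `f ∈ B_ε` has a translate `f B_δ` inside `B_ε`. -/
theorem exists_mul_mem_shrunkBall {X : Type*} [MetricSpace X] [CompactSpace X] (C : Set X)
    {ε : ℝ} (hε : 0 < ε) {f : X ≃ₜ X} (hf : f ∈ shrunkBall C ε) :
    ∃ δ > 0, ∀ g ∈ shrunkBall C δ, f * g ∈ shrunkBall C ε := by
  have hK : IsCompact ((Metric.thickening ε C)ᶜ) :=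
    Metric.isOpen_thickening.isClosed_compl.isCompact
  obtain ⟨ε₁, h1, hb⟩ : ∃ ε₁ < ε, ∀ x, x ∉ Metric.thickening ε C →
      dist (f x) x ≤ ε₁ ∧ dist (f⁻¹ x) x ≤ ε₁ := by
    rcases ((Metric.thickening ε C)ᶜ).eq_empty_or_nonempty with he | hne
    · exact ⟨0, hε, fun x hx => absurd (show x ∈ (Metric.thickening ε C)ᶜ from hx) (by simp [he])⟩
    · have hc : Continuous fun x => max (dist (f x) x) (dist (f⁻¹ x) x) :=
        (f.continuous.dist continuous_id).max ((f⁻¹).continuous.dist continuous_id)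
      obtain ⟨x₀, hx₀, hm⟩ := hK.exists_isMaxOn hne hc.continuousOn
      exact ⟨_, max_lt (hf x₀ hx₀).1 (hf x₀ hx₀).2, fun x hx => max_le_iff.1 (hm hx)⟩
  have huc := CompactSpace.uniformContinuous_of_continuous f.continuous
  obtain ⟨δ', hδ', hd⟩ := Metric.uniformContinuous_iff.1 huc (ε - ε₁) (by linarith)
  refine ⟨min (min δ' (ε - ε₁)) ε, lt_min (lt_min hδ' (by linarith)) hε, fun g hg x hx => ?_⟩
  have hδ1 : min (min δ' (ε - ε₁)) ε ≤ δ' := (min_le_left _ _).trans (min_le_left _ _)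
  have hδ2 : min (min δ' (ε - ε₁)) ε ≤ ε - ε₁ := (min_le_left _ _).trans (min_le_right _ _)
  generalize min (min δ' (ε - ε₁)) ε = δ at *
  constructor
  · have hδε : δ ≤ ε := by
      have := (hb x hx).1
      have := dist_nonneg (x := f x) (y := x)
      linarith
    have h2 := (hg x (fun hx' => hx (Metric.thickening_mono hδε C hx'))).1
    have h3 := hd (h2.trans_le hδ1)
    have h4 := (hb x hx).1
    have h5 := dist_triangle (f (g x)) (f x) x
    change dist (f (g x)) x < ε
    linarith
  · have hx2 : f⁻¹ x ∉ Metric.thickening δ C := by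
      intro hx'
      obtain ⟨c, hc, hxc⟩ := Metric.mem_thickening_iff.1 hx'
      refine hx (Metric.mem_thickening_iff.2 ⟨c, hc, ?_⟩)
      have h4 := (hb x hx).2
      have h5 := dist_triangle_left x c (f⁻¹ x)
      linarith
    have h2 := (hg _ hx2).2
    have h4 := (hb x hx).2
    have h5 := dist_triangle (g⁻¹ (f⁻¹ x)) (f⁻¹ x) x
    rw [mul_inv_rev]
    change dist (g⁻¹ (f⁻¹ x)) x < ε
    linarith

theorem one_mem_shrunkBall {X : Type*} [MetricSpace X] (C : Set X) {ε : ℝ} (hε : 0 < ε) :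
    (1 : X ≃ₜ X) ∈ shrunkBall C ε := by
  intro x _
  simp [hε]

/-- A set is a union of translates `f B_ε` (with `ε > 0`) iff it contains, with each of its
points `f`, some `f B_ε`. -/
theorem union_translates_iff {X : Type*} [MetricSpace X] [CompactSpace X] (C : Set X)
    (U : Set (X ≃ₜ X)) :
    (∃ S : Set ((X ≃ₜ X) × ℝ), (∀ p ∈ S, 0 < p.2) ∧
        U = ⋃ p ∈ S, shrunkTranslate C p.1 p.2) ↔
      ∀ f ∈ U, ∃ ε > 0, shrunkTranslate C f ε ⊆ U := by
  constructor
  · rintro ⟨S, hS, rfl⟩ f hf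
    obtain ⟨p, hp, b, hb, rfl⟩ := Set.mem_iUnion₂.1 hf
    obtain ⟨δ, hδ, h⟩ := exists_mul_mem_shrunkBall C (hS p hp) hb
    refine ⟨δ, hδ, ?_⟩
    rintro _ ⟨g, hg, rfl⟩
    exact Set.mem_iUnion₂.2 ⟨p, hp, b * g, h g hg, (mul_assoc _ _ _).symm⟩
  · intro h
    refine ⟨{p | 0 < p.2 ∧ shrunkTranslate C p.1 p.2 ⊆ U}, fun p hp => hp.1, ?_⟩
    apply Set.Subset.antisymm
    · intro f hf
      obtain ⟨ε, hε, hU⟩ := h f hf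
      exact Set.mem_iUnion₂.2 ⟨(f, ε), ⟨hε, hU⟩, 1, one_mem_shrunkBall C hε, mul_one f⟩
    · exact Set.iUnion₂_subset fun p hp => hp.2

/-- The topology `τ_{k|C}` on the homeomorphism group `H(X)` of a compact metric space `X`:
its open sets are the unions of translates of the sets `B_ε`, `ε > 0`. -/
@[reducible] def shrunkTopology {X : Type*} [MetricSpace X] [CompactSpace X] (C : Set X) :
    TopologicalSpace (X ≃ₜ X) where
  IsOpen U := ∃ S : Set ((X ≃ₜ X) × ℝ), (∀ p ∈ S, 0 < p.2) ∧
    U = ⋃ p ∈ S, shrunkTranslate C p.1 p.2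
  isOpen_univ := (union_translates_iff C _).2 fun _ _ => ⟨1, one_pos, Set.subset_univ _⟩
  isOpen_inter U V hU hV := by
    rw [union_translates_iff] at *
    rintro f ⟨hfU, hfV⟩
    obtain ⟨ε, hε, hεU⟩ := hU f hfU
    obtain ⟨δ, hδ, hδV⟩ := hV f hfV
    exact ⟨min ε δ, lt_min hε hδ, Set.subset_inter
      ((Set.image_mono (shrunkBall_mono C (min_le_left _ _))).trans hεU)
      ((Set.image_mono (shrunkBall_mono C (min_le_right _ _))).trans hδV)⟩
  isOpen_sUnion 𝒰 h𝒰 := by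
    rw [union_translates_iff]
    rintro f ⟨U, hU, hfU⟩
    obtain ⟨ε, hε, hεU⟩ := (union_translates_iff C U).1 (h𝒰 U hU) f hfU
    exact ⟨ε, hε, hεU.trans (Set.subset_sUnion_of_mem hU)⟩

/-- `t` is the minimum Hausdorff group topology on `G`: a Hausdorff group topology all of whose
open sets are open in every Hausdorff group topology on `G`. -/
structure IsMinimumHausdorffGroupTopology (G : Type*) [Group G] (t : TopologicalSpace G) :
    Prop where
  isTopologicalGroup : @IsTopologicalGroup G t _
  t2Space : @T2Space G t
  minimum : ∀ s : TopologicalSpace G, @IsTopologicalGroup G s _ → @T2Space G s →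
    ∀ U : Set G, @IsOpen G t U → @IsOpen G s U

/-!
Write `O` for the one-manifold part of `X` and `C` for its complement. The sets `B_ε` for the
closed set `C` are symmetric, satisfy `B_{ε/2} B_{ε/2} ⊆ B_ε`, and, `X` being compact and `C`
being invariant under all homeomorphisms, are preserved by conjugation up to shrinking `ε`. So they
are a basis of neighbourhoods of the identity for a group topology on `H(X)`, and density of `O`
makes it Hausdorff.

For minimality, let `s` be a Hausdorff group topology on `G` and let `U ⊆ X` be an open arc. Some
two elements `g, g'` of `G` that move only points of `U` do not commute: given `g ≠ 1`, take an
open arc `I ⊆ U` with `g(I) ∩ I = ∅` and let `g' ≠ 1` move only points of `I`. The `h` such that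
`h g h⁻¹` and `g'` do not commute form an `s`-open set around `1`, and each of them satisfies
`h(U) ∩ U ≠ ∅`. Hence `{h ∈ G | h(U) ∩ U ≠ ∅}` is an `s`-neighbourhood of `1`
(`setOf_image_inter_nonempty_mem_nhds_one`).

It remains to see that finitely many such conditions force `h` to lie in `B_ε`. Let `e : ℝ → X` be
an open embedding with small image. If `h` carries a point of each of the arcs `e (-2, -1)`,
`e (1, 2)` and `e (2, 3)` into the same arc, say `e u₁`, `e u₂`, `e u₃` to `e v₁`, `e v₂`, `e v₃`,
then `h (e [u₁, u₂]) = e [v₁, v₂]`: a connected set that joins `e v₁` to `e v₂` and misses a point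
of `e [v₁, v₂]` has to contain `e v₃ = h (e u₃)`, which `h (e [u₁, u₂])` does not; so it contains
`e [v₁, v₂]`, and its preimage, being connected, is all of `[u₁, u₂]`
(`Topology.IsOpenEmbedding.image_Icc_subset_image_Icc`). So `h` moves no point of `e (-1, 1)` far, and
finitely many sets `e (-1, 1)` cover the compact set `X \ C_ε ⊆ O`.
-/

open Set Filter Topology

/-! ### Arcs in the real line and in `X` -/

theorem nonempty_real_homeomorph_Ioo {a b : ℝ} (hab : a < b) : Nonempty (ℝ ≃ₜ Ioo a b) := by
  have hη : 0 < (b - a) / 2 := by linarith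
  let A := affineHomeomorph ((b - a) / 2) ((a + b) / 2) hη.ne'
  have hA : A '' Ioo (-1) 1 = Ioo a b := by
    rw [affineHomeomorph_image_Ioo _ _ _ _ hη]
    congr 1 <;> ring
  exact ⟨(orderIsoIooNegOneOne ℝ).toHomeomorph.trans
    ((A.image (Ioo (-1) 1)).trans (Homeomorph.setCongr hA))⟩

theorem exists_isOpenEmbedding_range_eq_Ioo {a b : ℝ} (hab : a < b) :
    ∃ φ : ℝ → ℝ, IsOpenEmbedding φ ∧ range φ = Ioo a b := by
  obtain ⟨ψ⟩ := nonempty_real_homeomorph_Ioo hab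
  refine ⟨Subtype.val ∘ ψ, isOpen_Ioo.isOpenEmbedding_subtypeVal.comp ψ.isOpenEmbedding, ?_⟩
  rw [range_comp, ψ.range_coe, image_univ, Subtype.range_coe]

section Arcs

variable {X : Type*} [TopologicalSpace X]

theorem exists_isOpenEmbedding_range_eq_image_Ioo {e : ℝ → X} (he : IsOpenEmbedding e) {a b : ℝ}
    (hab : a < b) : ∃ f : ℝ → X, IsOpenEmbedding f ∧ range f = e '' Ioo a b := by
  obtain ⟨φ, hφ, hr⟩ := exists_isOpenEmbedding_range_eq_Ioo hab
  exact ⟨e ∘ φ, he.comp hφ, by rw [range_comp, hr]⟩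

theorem nonempty_range_homeomorph_Ioo {e : ℝ → X} (he : IsEmbedding e) :
    Nonempty (range e ≃ₜ Ioo (0 : ℝ) 1) :=
  (nonempty_real_homeomorph_Ioo one_pos).map he.toHomeomorph.symm.trans

/-- Points of the one-manifold part have arbitrarily small open arcs around them. -/
theorem exists_isOpenEmbedding_of_mem_oneManifoldPart {x : X} (hx : x ∈ oneManifoldPart X)
    {W : Set X} (hW : W ∈ 𝓝 x) :
    ∃ e : ℝ → X, IsOpenEmbedding e ∧ e 0 = x ∧ range e ⊆ W := by
  obtain ⟨N, hN, ⟨φ⟩⟩ := hx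
  obtain ⟨V, hVW, hVo, hxV⟩ := mem_nhds_iff.1 (inter_mem hW hN)
  -- The trace `T` on `(0,1)` of the open set `V ⊆ N` is open in `ℝ`.
  let f : Ioo (0 : ℝ) 1 → X := Subtype.val ∘ φ.symm
  have hf : IsEmbedding f := IsEmbedding.subtypeVal.comp φ.symm.isEmbedding
  have hTo : IsOpen (f ⁻¹' V) := hVo.preimage hf.continuous
  let t : Ioo (0 : ℝ) 1 := φ ⟨x, (hVW hxV).2⟩
  have hft : f t = x := by simp [f, t]
  have hmem : (Subtype.val '' (f ⁻¹' V) : Set ℝ) ∈ 𝓝 (t : ℝ) :=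
    (isOpen_Ioo.isOpenEmbedding_subtypeVal.isOpenMap _ hTo).mem_nhds
      ⟨t, by rwa [mem_preimage, hft], rfl⟩
  obtain ⟨a, b, ⟨hat, htb⟩, hab⟩ := mem_nhds_iff_exists_Ioo_subset.1 hmem
  obtain ⟨ψ, hψ, hr⟩ := exists_isOpenEmbedding_range_eq_Ioo (hat.trans htb)
  have hψT : ∀ s, ∃ y ∈ f ⁻¹' V, (y : ℝ) = ψ s := fun s => hab (hr ▸ mem_range_self s)
  have hψ01 : ∀ s, ψ s ∈ Ioo (0 : ℝ) 1 := fun s => by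
    obtain ⟨y, -, hy⟩ := hψT s
    exact hy ▸ y.2
  let k : ℝ → Ioo (0 : ℝ) 1 := fun s => ⟨ψ s, hψ01 s⟩
  have hk : IsOpenEmbedding k :=
    (isOpen_Ioo.isOpenEmbedding_subtypeVal.of_comp_iff k).1 hψ
  have hkV : ∀ s, f (k s) ∈ V := fun s => by
    obtain ⟨y, hyV, hy⟩ := hψT s
    have : k s = y := Subtype.ext hy.symm
    rw [this]
    exact hyV
  have hopen : IsOpen (range (f ∘ k)) := by
    -- `range (f ∘ k)` is relatively open in `N` and contained in the open set `V ⊆ N`.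
    obtain ⟨P, hPo, hP⟩ := isOpen_induced_iff.1
      ((φ.symm.isOpenEmbedding.comp hk).isOpen_range)
    have : range (f ∘ k) = P ∩ V := by
      ext y
      constructor
      · rintro ⟨s, rfl⟩
        refine ⟨?_, hkV s⟩
        have : φ.symm (k s) ∈ Subtype.val ⁻¹' P := hP ▸ mem_range_self s
        exact this
      · rintro ⟨hyP, hyV⟩
        have : (⟨y, (hVW hyV).2⟩ : N) ∈ range (φ.symm ∘ k) := hP ▸ hyP
        obtain ⟨s, hs⟩ := this
        exact ⟨s, congrArg Subtype.val hs⟩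
    rw [this]
    exact hPo.inter hVo
  have hfk : IsOpenEmbedding (f ∘ k) := ⟨hf.comp hk.isEmbedding, hopen⟩
  obtain ⟨s₀, hs₀⟩ : (t : ℝ) ∈ range ψ := hr ▸ ⟨hat, htb⟩
  refine ⟨(f ∘ k) ∘ (Homeomorph.addRight s₀), hfk.comp (Homeomorph.isOpenEmbedding _), ?_, ?_⟩
  · have : k s₀ = t := Subtype.ext hs₀
    simp [this, hft]
  · rintro _ ⟨s, rfl⟩
    exact (hVW (hkV _)).1

theorem range_subset_oneManifoldPart {e : ℝ → X} (he : IsOpenEmbedding e) :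
    range e ⊆ oneManifoldPart X :=
  fun _ hx => ⟨range e, he.isOpen_range.mem_nhds hx, nonempty_range_homeomorph_Ioo he.isEmbedding⟩

theorem isOpen_oneManifoldPart : IsOpen (oneManifoldPart X) := by
  refine isOpen_iff_mem_nhds.2 fun x hx => ?_
  obtain ⟨e, he, rfl, -⟩ := exists_isOpenEmbedding_of_mem_oneManifoldPart hx univ_mem
  exact mem_of_superset (he.isOpen_range.mem_nhds (mem_range_self _))
    (range_subset_oneManifoldPart he)

theorem map_mem_oneManifoldPart (f : X ≃ₜ X) {x : X} (hx : x ∈ oneManifoldPart X) :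
    f x ∈ oneManifoldPart X := by
  obtain ⟨e, he, rfl, -⟩ := exists_isOpenEmbedding_of_mem_oneManifoldPart hx univ_mem
  exact range_subset_oneManifoldPart (f.isOpenEmbedding.comp he) (mem_range_self 0)

/-- An embedded line `γ` that agrees with an open arc `e` at the ends of `[u₁, u₂]` and at a further
parameter `u₃`, in the sense that `γ uᵢ = e vᵢ` with `v₁ ≤ v₂ < v₃`, runs inside `e [v₁, v₂]`
between `u₁` and `u₂`. -/
theorem Topology.IsOpenEmbedding.image_Icc_subset_image_Icc [T2Space X] {e γ : ℝ → X}
    (he : IsOpenEmbedding e) (hγ : IsEmbedding γ) {u₁ u₂ u₃ v₁ v₂ v₃ : ℝ} (hu : u₁ ≤ u₂)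
    (hu₃ : u₂ < u₃) (hv : v₁ ≤ v₂) (hv₃ : v₂ < v₃) (h₁ : γ u₁ = e v₁) (h₂ : γ u₂ = e v₂) (h₃ : γ u₃ = e v₃) :
    γ '' Icc u₁ u₂ ⊆ e '' Icc v₁ v₂ := by
  have hJ : IsPreconnected (γ '' Icc u₁ u₂) := isPreconnected_Icc.image _ hγ.continuous.continuousOn
  have hv₃J : e v₃ ∉ γ '' Icc u₁ u₂ := by
    rintro ⟨t, ht, hte⟩
    rw [← h₃] at hte
    exact absurd (hγ.injective hte ▸ ht.2) hu₃.not_ge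
  have hv₁J : e v₁ ∈ γ '' Icc u₁ u₂ := ⟨u₁, left_mem_Icc.2 hu, h₁⟩
  have hv₂J : e v₂ ∈ γ '' Icc u₁ u₂ := ⟨u₂, right_mem_Icc.2 hu, h₂⟩
  have hsub : e '' Icc v₁ v₂ ⊆ γ '' Icc u₁ u₂ := by
    rintro _ ⟨z, hz, rfl⟩
    by_contra hzJ
    have hzv₂ : z < v₂ := hz.2.lt_of_ne fun h => hzJ (h ▸ hv₂J)
    -- Missing `e z` and `e v₃`, the connected set cannot leave the arc `e (z, v₃)`.
    have hcl : IsClosed (e '' Icc z v₃) := (isCompact_Icc.image he.continuous).isClosed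
    have hcover : γ '' Icc u₁ u₂ ⊆ e '' Ioo z v₃ ∪ (e '' Icc z v₃)ᶜ := by
      intro y hy
      by_cases hyc : y ∈ e '' Icc z v₃
      · obtain ⟨w, hw, rfl⟩ := hyc
        refine Or.inl ⟨w, ⟨hw.1.lt_of_ne ?_, hw.2.lt_of_ne ?_⟩, rfl⟩
        · rintro rfl
          exact hzJ hy
        · rintro rfl
          exact hv₃J hy
      · exact Or.inr hyc
    have hall := hJ.subset_left_of_subset_union (he.isOpenMap _ isOpen_Ioo) hcl.isOpen_compl
      (disjoint_compl_right.mono_left (image_mono Ioo_subset_Icc_self)) hcover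
      ⟨e v₂, hv₂J, mem_image_of_mem e ⟨hzv₂, hv₃⟩⟩
    obtain ⟨w, hw, hwe⟩ := hall hv₁J
    exact absurd (hz.1.trans_lt hw.1) (he.injective hwe).symm.not_lt
  have himage : γ '' (γ ⁻¹' (e '' Icc v₁ v₂)) = e '' Icc v₁ v₂ :=
    image_preimage_eq_of_subset (hsub.trans (image_subset_range _ _))
  have hpre : IsPreconnected (γ ⁻¹' (e '' Icc v₁ v₂)) := by
    rw [← hγ.isInducing.isPreconnected_image, himage]
    exact isPreconnected_Icc.image _ he.continuous.continuousOn
  refine image_subset_iff.2 (hpre.Icc_subset ?_ ?_)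
  · exact ⟨v₁, left_mem_Icc.2 hv, h₁.symm⟩
  · exact ⟨v₂, right_mem_Icc.2 hv, h₂.symm⟩

end Arcs

/-! ### The topology `τ_{k|C}` -/

section ShrunkTopology

variable {X : Type*} [MetricSpace X]

theorem inv_mem_shrunkBall {C : Set X} {ε : ℝ} {h : X ≃ₜ X} (hh : h ∈ shrunkBall C ε) :
    h⁻¹ ∈ shrunkBall C ε :=
  fun x hx => (hh x hx).symm

theorem dist_mul_apply_lt_of_mem_shrunkBall {C : Set X} {ε : ℝ} {g h : X ≃ₜ X}
    (hg : g ∈ shrunkBall C (ε / 2)) (hh : h ∈ shrunkBall C (ε / 2)) {x : X}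
    (hx : x ∉ Metric.thickening ε C) : dist ((g * h) x) x < ε := by
  have hhx : dist (h x) x < ε / 2 := by
    by_cases hε : ε / 2 ≤ ε
    · exact (hh x fun hx' => hx (Metric.thickening_mono hε C hx')).1
    · have : Metric.thickening (ε / 2) C = ∅ :=
        Metric.thickening_of_nonpos (by linarith) C
      exact (hh x (by simp [this])).1
  have hmem : h x ∉ Metric.thickening (ε / 2) C := by
    intro hx'
    obtain ⟨c, hc, hxc⟩ := Metric.mem_thickening_iff.1 hx'
    refine hx (Metric.mem_thickening_iff.2 ⟨c, hc, ?_⟩)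
    have := dist_triangle_left x c (h x)
    linarith
  have h1 := (hg _ hmem).1
  have h2 := dist_triangle (g (h x)) (h x) x
  rw [Homeomorph.mul_apply]
  linarith

theorem mul_mem_shrunkBall {C : Set X} {ε : ℝ} {g h : X ≃ₜ X}
    (hg : g ∈ shrunkBall C (ε / 2)) (hh : h ∈ shrunkBall C (ε / 2)) :
    g * h ∈ shrunkBall C ε := by
  intro x hx
  refine ⟨dist_mul_apply_lt_of_mem_shrunkBall hg hh hx, ?_⟩
  rw [mul_inv_rev]
  exact dist_mul_apply_lt_of_mem_shrunkBall (inv_mem_shrunkBall hh) (inv_mem_shrunkBall hg) hx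

theorem exists_thickening_disjoint {C K : Set X} (hC : IsClosed C) (hK : IsCompact K)
    (hKC : Disjoint K C) : ∃ δ > 0, ∀ x ∈ K, x ∉ Metric.thickening δ C := by
  obtain ⟨δ, hδ, hd⟩ := hKC.exists_thickenings hK hC
  exact ⟨δ, hδ, fun x hx => disjoint_left.1 hd (Metric.self_subset_thickening hδ K hx)⟩

variable [CompactSpace X]

theorem exists_conj_mem_shrunkBall {C : Set X} (hC : IsClosed C) (f : X ≃ₜ X)
    (hfC : ∀ x ∈ C, f x ∈ C) {ε : ℝ} (hε : 0 < ε) :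
    ∃ δ > 0, ∀ g ∈ shrunkBall C δ, f * g * f⁻¹ ∈ shrunkBall C ε := by
  have hK : IsCompact ((f⁻¹ : X ≃ₜ X) '' (Metric.thickening ε C)ᶜ) :=
    Metric.isOpen_thickening.isClosed_compl.isCompact.image (f⁻¹).continuous
  have hKC : Disjoint ((f⁻¹ : X ≃ₜ X) '' (Metric.thickening ε C)ᶜ) C := by
    refine disjoint_left.2 ?_
    rintro _ ⟨x, hx, rfl⟩ hxC
    refine hx (Metric.self_subset_thickening hε C ?_)
    simpa using hfC _ hxC
  obtain ⟨δ₁, hδ₁, hd⟩ := exists_thickening_disjoint hC hK hKC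
  obtain ⟨δ₂, hδ₂, hu⟩ := Metric.uniformContinuous_iff.1
    (CompactSpace.uniformContinuous_of_continuous f.continuous) ε hε
  have key : ∀ g ∈ shrunkBall C (min δ₁ δ₂), ∀ x, x ∉ Metric.thickening ε C →
      dist ((f * g * f⁻¹) x) x < ε := by
    intro g hg x hx
    have h1 : f⁻¹ x ∉ Metric.thickening (min δ₁ δ₂) C := fun h =>
      hd _ (mem_image_of_mem _ hx) (Metric.thickening_mono (min_le_left _ _) C h)
    simpa using hu ((hg _ h1).1.trans_le (min_le_right _ _))
  refine ⟨min δ₁ δ₂, lt_min hδ₁ hδ₂, fun g hg x hx => ⟨key g hg x hx, ?_⟩⟩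
  have := key _ (inv_mem_shrunkBall hg) x hx
  rwa [show (f * g * f⁻¹)⁻¹ = f * g⁻¹ * f⁻¹ by group]

theorem hasBasis_nhds_shrunkTopology (C : Set X) (f : X ≃ₜ X) :
    (@nhds _ (shrunkTopology C) f).HasBasis (fun ε : ℝ => 0 < ε) (shrunkTranslate C f) := by
  let _ := shrunkTopology C
  refine ⟨fun U => ?_⟩
  rw [mem_nhds_iff]
  constructor
  · rintro ⟨V, hVU, hVo, hfV⟩
    obtain ⟨ε, hε, h⟩ := (union_translates_iff C V).1 hVo f hfV
    exact ⟨ε, hε, h.trans hVU⟩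
  · rintro ⟨ε, hε, h⟩
    refine ⟨_, h, ⟨{(f, ε)}, by simpa using hε, by simp⟩, 1, one_mem_shrunkBall C hε, mul_one f⟩

theorem hasBasis_nhds_one_shrunkTopology (C : Set X) :
    (@nhds _ (shrunkTopology C) 1).HasBasis (fun ε : ℝ => 0 < ε) (shrunkBall C) := by
  convert hasBasis_nhds_shrunkTopology C 1 using 1
  funext ε
  simp [shrunkTranslate]

theorem isTopologicalGroup_shrunkTopology {C : Set X} (hC : IsClosed C)
    (hinv : ∀ f : X ≃ₜ X, ∀ x ∈ C, f x ∈ C) :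
    @IsTopologicalGroup (X ≃ₜ X) (shrunkTopology C) _ := by
  let _ := shrunkTopology C
  have hb := hasBasis_nhds_one_shrunkTopology C
  refine IsTopologicalGroup.of_nhds_one ?_ ?_ ?_ ?_
  · refine ((hb.prod_self).tendsto_iff hb).2 fun ε hε => ⟨ε / 2, half_pos hε, ?_⟩
    rintro ⟨g, h⟩ ⟨hg, hh⟩
    exact mul_mem_shrunkBall hg hh
  · exact (hb.tendsto_iff hb).2 fun ε hε => ⟨ε, hε, fun g => inv_mem_shrunkBall⟩
  · intro f
    exact (hasBasis_nhds_shrunkTopology C f).eq_of_same_basis (hb.map _)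
  · intro f
    exact (hb.tendsto_iff hb).2 fun ε hε => exists_conj_mem_shrunkBall hC f (hinv f) hε

theorem t2Space_shrunkTopology {C : Set X} (hC : IsClosed C) (hd : Dense Cᶜ)
    (hinv : ∀ f : X ≃ₜ X, ∀ x ∈ C, f x ∈ C) :
    @T2Space (X ≃ₜ X) (shrunkTopology C) := by
  let _ := shrunkTopology C
  have := isTopologicalGroup_shrunkTopology hC hinv
  refine IsTopologicalGroup.t2Space_of_one_sep fun h hne => ?_
  obtain ⟨x, hxC, hx⟩ : ∃ x ∈ Cᶜ, h x ≠ x := by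
    by_contra! hfix
    refine hne (Homeomorph.ext fun x => ?_)
    exact congrFun (h.continuous.ext_on hd continuous_id hfix) x
  obtain ⟨δ, hδ, hxδ⟩ := exists_thickening_disjoint hC isCompact_singleton
    (disjoint_singleton_left.2 hxC)
  have hpos : 0 < min δ (dist (h x) x) := lt_min hδ (dist_pos.2 hx)
  refine ⟨_, (hasBasis_nhds_one_shrunkTopology C).mem_of_mem hpos, fun hmem => ?_⟩
  have := (hmem x fun hx' => hxδ x rfl (Metric.thickening_mono (min_le_left _ _) C hx')).1
  exact absurd (this.trans_le (min_le_right _ _)) (lt_irrefl _)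

end ShrunkTopology

/-! ### Supports and commutation -/

section Support

variable {X : Type*} [TopologicalSpace X]

theorem commute_of_disjoint_movedSet {g h : X ≃ₜ X} (hd : Disjoint (movedSet g) (movedSet h)) :
    Commute g h := by
  have hp : Equiv.Perm.Disjoint g.toEquiv h.toEquiv := fun x =>
    or_iff_not_imp_left.2 fun hx => not_not.1 fun hx' => disjoint_left.1 hd hx hx'
  exact Homeomorph.toEquiv_injective hp.commute

theorem movedSet_conj (f g : X ≃ₜ X) : movedSet (f * g * f⁻¹) = f '' movedSet g := by
  ext x
  rw [Homeomorph.image_eq_preimage_symm]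
  change f (g (f.symm x)) ≠ x ↔ g (f.symm x) ≠ f.symm x
  rw [Ne, Ne, Homeomorph.eq_symm_apply]

theorem movedSet_nonempty {g : X ≃ₜ X} (hg : g ≠ 1) : (movedSet g).Nonempty := by
  by_contra! h
  refine hg (Homeomorph.ext fun x => ?_)
  by_contra hx
  exact (h ▸ (show x ∈ movedSet g from hx) : x ∈ (∅ : Set X))

variable {G : Subgroup (X ≃ₜ X)}

/-- A group that is locally non-trivial on open arcs is locally non-commutative on them. -/
theorem exists_not_commute_of_movedSet_subset [T2Space X]
    (hG : ∀ e : ℝ → X, IsOpenEmbedding e → ∃ g ∈ G, g ≠ 1 ∧ movedSet g ⊆ range e)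
    {e : ℝ → X} (he : IsOpenEmbedding e) :
    ∃ g ∈ G, ∃ g' ∈ G, movedSet g ⊆ range e ∧ movedSet g' ⊆ range e ∧ ¬ Commute g g' := by
  obtain ⟨g, hgG, hg1, hge⟩ := hG e he
  obtain ⟨x, hx⟩ := movedSet_nonempty hg1
  obtain ⟨V, W, hVo, hWo, hxV, hxW, hVW⟩ := t2_separation (show g x ≠ x from hx)
  have hN : W ∩ g ⁻¹' V ∩ range e ∈ 𝓝 x :=
    ((hWo.inter (hVo.preimage g.continuous)).inter he.isOpen_range).mem_nhds
      ⟨⟨hxW, hxV⟩, hge hx⟩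
  -- `I = range i` is an open arc inside `range e` with `g(I) ∩ I = ∅`.
  obtain ⟨i, hi, -, hiN⟩ := exists_isOpenEmbedding_of_mem_oneManifoldPart
    (range_subset_oneManifoldPart he (hge hx)) hN
  obtain ⟨g', hgG', hg1', hgi⟩ := hG i hi
  refine ⟨g, hgG, g', hgG', hge, fun y hy => (hiN (hgi hy)).2, fun hcomm => ?_⟩
  obtain ⟨y, hy⟩ := movedSet_nonempty hg1'
  have hconj : g * g' * g⁻¹ = g' := by rw [hcomm.eq, mul_inv_cancel_right]
  have hy' : y ∈ g '' movedSet g' := by rwa [← movedSet_conj, hconj]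
  obtain ⟨z, hz, rfl⟩ := hy'
  exact disjoint_left.1 hVW (hiN (hgi hz)).1.2 (hiN (hgi hy)).1.1

theorem setOf_image_inter_nonempty_mem_nhds_one [T2Space X]
    (hG : ∀ e : ℝ → X, IsOpenEmbedding e → ∃ g ∈ G, g ≠ 1 ∧ movedSet g ⊆ range e)
    [TopologicalSpace G] [IsTopologicalGroup G] [T2Space G] {e : ℝ → X} (he : IsOpenEmbedding e) :
    {h : G | ∃ x ∈ range e, (h : X ≃ₜ X) x ∈ range e} ∈ 𝓝 (1 : G) := by
  obtain ⟨g, hgG, g', hgG', hge, hge', hcomm⟩ := exists_not_commute_of_movedSet_subset hG he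
  let a : G := ⟨g, hgG⟩
  let b : G := ⟨g', hgG'⟩
  have hopen : IsOpen {h : G | h * a * h⁻¹ * b ≠ b * (h * a * h⁻¹)} :=
    isOpen_ne_fun (by fun_prop) (by fun_prop)
  refine mem_of_superset (hopen.mem_nhds ?_) fun h hh => ?_
  · intro hab
    refine hcomm (congrArg Subtype.val (a₁ := a * b) (a₂ := b * a) ?_)
    simpa using hab
  · by_contra hne
    refine hh (Subtype.ext (commute_of_disjoint_movedSet (g := h.1 * g * h.1⁻¹) (h := g') ?_).eq)
    rw [movedSet_conj]
    refine disjoint_left.2 ?_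
    rintro _ ⟨x, hx, rfl⟩ hhx
    exact hne ⟨x, hge hx, hge' hhx⟩

end Support

/-! ### Minimality -/

section Minimality

variable {X : Type*} [MetricSpace X] {G : Subgroup (X ≃ₜ X)} [TopologicalSpace G]
  [IsTopologicalGroup G] [T2Space G]

/-- In a Hausdorff group topology, elements near `1` are uniformly close to the identity near a given
point of the one-manifold part. -/
theorem exists_nhds_forall_dist_lt
    (hG : ∀ e : ℝ → X, IsOpenEmbedding e → ∃ g ∈ G, g ≠ 1 ∧ movedSet g ⊆ range e)
    {x : X} (hx : x ∈ oneManifoldPart X) {ε : ℝ} (hε : 0 < ε) :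
    ∃ N ∈ 𝓝 x, ∀ᶠ h : G in 𝓝 (1 : G), ∀ y ∈ N, dist ((h : X ≃ₜ X) y) y < ε := by
  obtain ⟨e, he, rfl, heb⟩ := exists_isOpenEmbedding_of_mem_oneManifoldPart hx
    (Metric.ball_mem_nhds x (half_pos hε))
  have hnear : ∀ a b : ℝ, a < b →
      ∀ᶠ h : G in 𝓝 (1 : G), ∃ u ∈ Ioo a b, ∃ v ∈ Ioo a b, (h : X ≃ₜ X) (e u) = e v := by
    intro a b hab
    obtain ⟨f, hf, hr⟩ := exists_isOpenEmbedding_range_eq_image_Ioo he hab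
    filter_upwards [setOf_image_inter_nonempty_mem_nhds_one hG hf] with h hh
    rw [hr] at hh
    obtain ⟨_, ⟨u, hu, rfl⟩, v, hv, hvu⟩ := hh
    exact ⟨u, hu, v, hv, hvu.symm⟩
  refine ⟨e '' Ioo (-1) 1, (he.isOpenMap _ isOpen_Ioo).mem_nhds (mem_image_of_mem e (by simp)), ?_⟩
  filter_upwards [hnear (-2) (-1) (by norm_num), hnear 1 2 (by norm_num), hnear 2 3 (by norm_num)]
    with h ⟨u₁, hu₁, v₁, hv₁, h₁⟩ ⟨u₂, hu₂, v₂, hv₂, h₂⟩ ⟨u₃, hu₃, v₃, hv₃, h₃⟩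
  rintro _ ⟨t, ht, rfl⟩
  obtain ⟨hu₁, hu₁'⟩ := hu₁
  obtain ⟨hv₁, hv₁'⟩ := hv₁
  have hsub := he.image_Icc_subset_image_Icc
    (h.1.isEmbedding.comp he.isEmbedding) (by linarith [hu₂.1]) (hu₂.2.trans hu₃.1)
    (by linarith [hv₂.1]) (hv₂.2.trans hv₃.1) h₁ h₂ h₃
  obtain ⟨s, -, hs⟩ := image_subset_iff.1 hsub
    (show t ∈ Icc u₁ u₂ from ⟨by linarith [ht.1], by linarith [ht.2, hu₂.1]⟩)
  have hs' : e s = h.1 (e t) := hs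
  rw [← hs']
  have d1 := Metric.mem_ball.1 (heb (mem_range_self s))
  have d2 := Metric.mem_ball.1 (heb (mem_range_self t))
  linarith [dist_triangle_right (e s) (e t) (e 0)]

theorem eventually_mem_shrunkBall [CompactSpace X]
    (hG : ∀ e : ℝ → X, IsOpenEmbedding e → ∃ g ∈ G, g ≠ 1 ∧ movedSet g ⊆ range e)
    {ε : ℝ} (hε : 0 < ε) :
    ∀ᶠ h : G in 𝓝 (1 : G), (h : X ≃ₜ X) ∈ shrunkBall (oneManifoldPart X)ᶜ ε := by
  have hK : IsCompact ((Metric.thickening ε (oneManifoldPart X)ᶜ)ᶜ) :=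
    Metric.isOpen_thickening.isClosed_compl.isCompact
  have hclose : ∀ᶠ h : G in 𝓝 (1 : G), ∀ y ∈ (Metric.thickening ε (oneManifoldPart X)ᶜ)ᶜ,
      dist ((h : X ≃ₜ X) y) y < ε := by
    refine hK.induction_on (p := fun K => ∀ᶠ h : G in 𝓝 (1 : G), ∀ y ∈ K,
      dist ((h : X ≃ₜ X) y) y < ε) (by simp) ?_ ?_ ?_
    · exact fun K L hKL hL => hL.mono fun h hh y hy => hh y (hKL hy)
    · intro K L hK hL
      filter_upwards [hK, hL] with h hhK hhL y hy
      exact hy.elim (hhK y) (hhL y)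
    · intro x hx
      have hxO : x ∈ oneManifoldPart X := not_not.1 fun hx' =>
        hx (Metric.self_subset_thickening hε _ hx')
      obtain ⟨N, hN, hNε⟩ := exists_nhds_forall_dist_lt hG hxO hε
      exact ⟨N, mem_nhdsWithin_of_mem_nhds hN, hNε⟩
  have hinv : Tendsto (fun h : G => h⁻¹) (𝓝 1) (𝓝 1) := by
    simpa using (continuous_inv (G := G)).tendsto 1
  filter_upwards [hclose, hinv.eventually hclose] with h h₁ h₂ x hx
  exact ⟨h₁ x hx, h₂ x hx⟩

end Minimality

theorem mainTheorem5 {X : Type*} [MetricSpace X] [CompactSpace X]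
    (hO : Dense (oneManifoldPart X))
    (G : Subgroup (X ≃ₜ X))
    (hG : ∀ U : Set X, IsOpen U → Nonempty (U ≃ₜ Set.Ioo (0 : ℝ) 1) →
      ∃ g ∈ G, g ≠ 1 ∧ movedSet g ⊆ U) :
    IsMinimumHausdorffGroupTopology G
      ((shrunkTopology (oneManifoldPart X)ᶜ).induced (Subtype.val : G → (X ≃ₜ X))) := by
  have hC : IsClosed (oneManifoldPart X)ᶜ := isOpen_oneManifoldPart.isClosed_compl
  have hinv : ∀ f : X ≃ₜ X, ∀ x ∈ (oneManifoldPart X)ᶜ, f x ∈ (oneManifoldPart X)ᶜ :=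
    fun f x hx hfx => hx (by simpa using map_mem_oneManifoldPart f⁻¹ hfx)
  have hG' : ∀ e : ℝ → X, IsOpenEmbedding e → ∃ g ∈ G, g ≠ 1 ∧ movedSet g ⊆ range e :=
    fun e he => hG _ he.isOpen_range (nonempty_range_homeomorph_Ioo he.isEmbedding)
  refine ⟨?_, ?_, ?_⟩
  · let _ := shrunkTopology (oneManifoldPart X)ᶜ
    have := isTopologicalGroup_shrunkTopology hC hinv
    exact topologicalGroup_induced G.subtype
  · let _ := shrunkTopology (oneManifoldPart X)ᶜ
    have : T2Space (X ≃ₜ X) := t2Space_shrunkTopology hC (by rwa [compl_compl]) hinv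
    exact (IsEmbedding.mk ⟨rfl⟩ Subtype.val_injective).t2Space
  · intro s hs ht U hU
    obtain ⟨W, hW, rfl⟩ := hU
    refine isOpen_iff_mem_nhds.2 fun f hf => ?_
    obtain ⟨ε, hε, hsub⟩ := (union_translates_iff _ W).1 hW f hf
    have htend : Tendsto (fun h : G => f⁻¹ * h) (𝓝 f) (𝓝 1) := by
      simpa using (continuous_const_mul f⁻¹).tendsto f
    filter_upwards [htend.eventually (eventually_mem_shrunkBall hG' hε)] with h hh
    exact hsub ⟨_, hh, by simp⟩
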